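/- Let $\mathcal L\supseteq\{0,1,+,-,\cdot,<\}$ be a language and let $T$ be a complete, model complete, o-minimal $\mathcal L$-theory extending the theory $\mathrm{RCF}$ of real closed ordered fields. Let $K\models T$, and let $\partial\colon K\to K$ be a $T$-derivation on $K$, that is, for each $n$, each open $U\subseteq K^n$ and each $\mathcal L(\emptyset)$-definable $\mathcal C^1$-function $F\colon U\to K$, $$\partial\big(F(u)\big)=\sum_{i=1}^n\frac{\partial F}{\partial Y_i}(u)\,\partial u_i\qquad\text{for all }u=(u_1,\ldots,u_n)\in U .$$ Call a set $Z\subseteq K$ *thin* if there are $r\in\mathbb N$ and an $\mathcal L(K)$-definable set $A\subseteq K^{1+r}$ of o-minimal dimension at most $r$ such that $(z,\partial z,\ldots,\partial^r z)\in A$ for all $z\in Z$. If $\partial$ is nontrivial (that is, $\partial x\neq 0$ for some $x\in K$), then no open interval $(a,b)\subseteq K$ with endpoints $a<b$ in $K\cup\{\pm\infty\}$ is thin. -/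

import Mathlib

universe u v w

namespace TDeriv

open FirstOrder FirstOrder.Language

/-! ### The language and the theory of real closed ordered fields -/

/-- The relation symbols of the language of ordered rings: a single binary symbol for `<`. -/
inductive OrderedRingRel : ℕ → Type
  | lt : OrderedRingRel 2

/-- The language `{0, 1, +, -, ·, <}` of ordered rings. -/
def orderedRing : FirstOrder.Language.{0, 0} where
  Functions := FirstOrder.Language.ring.Functions
  Relations := OrderedRingRel

/-- The symbol `<`. -/
abbrev ltSymb : orderedRing.Relations 2 := OrderedRingRel.lt

/-- The inclusion of the language of rings in the language of ordered rings. -/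
def ringIncl : FirstOrder.Language.ring →ᴸ orderedRing where
  onFunction := fun _ f => f
  onRelation := fun _ r => r.elim

/-- The formula `s < t` for terms `s`, `t` of the language of rings. -/
def ltF {n : ℕ} (s t : FirstOrder.Language.ring.Term (Empty ⊕ Fin n)) :
    orderedRing.BoundedFormula Empty n :=
  ltSymb.boundedFormula₂ (ringIncl.onTerm s) (ringIncl.onTerm t)

/-- The formula `s = t` for terms `s`, `t` of the language of rings. -/
def eqF {n : ℕ} (s t : FirstOrder.Language.ring.Term (Empty ⊕ Fin n)) :
    orderedRing.BoundedFormula Empty n :=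
  (ringIncl.onTerm s).bdEqual (ringIncl.onTerm t)

/-- `<` is irreflexive. -/
def ltIrrefl : orderedRing.Sentence := ∀' ∼(ltF (&0) (&0))

/-- `<` is transitive. -/
def ltTrans : orderedRing.Sentence :=
  ∀' ∀' ∀' (ltF (&0) (&1) ⟹ (ltF (&1) (&2) ⟹ ltF (&0) (&2)))

/-- `<` is total. -/
def ltTotal : orderedRing.Sentence :=
  ∀' ∀' (ltF (&0) (&1) ⊔ (eqF (&0) (&1) ⊔ ltF (&1) (&0)))

/-- Addition is strictly monotone. -/
def addLt : orderedRing.Sentence :=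
  ∀' ∀' ∀' (ltF (&0) (&1) ⟹ ltF ((&0) + (&2)) ((&1) + (&2)))

/-- Products of positive elements are positive. -/
def mulPos : orderedRing.Sentence :=
  ∀' ∀' (ltF 0 (&0) ⟹ (ltF 0 (&1) ⟹ ltF 0 ((&0) * (&1))))

/-- Positive elements are squares. -/
def posSquare : orderedRing.Sentence :=
  ∀' (ltF 0 (&0) ⟹ ∃' (eqF (&0) ((&1) * (&1))))

/-- The theory of real closed ordered fields: the field axioms, the axioms for an ordered field,
every positive element is a square, and every monic polynomial of odd degree has a zero. -/
def RCF : orderedRing.Theory :=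
  ringIncl.onTheory Theory.field ∪
    {ltIrrefl, ltTrans, ltTotal, addLt, mulPos, posSquare} ∪
    {σ | ∃ n : ℕ, Odd n ∧ σ = ringIncl.onSentence (Field.genericMonicPolyHasRoot n)}

/-! ### Theories in a language containing the language of ordered rings -/

section Theories

variable {L : FirstOrder.Language.{u, v}} (ι : orderedRing →ᴸ L)

/-- `T` extends the theory of real closed ordered fields: every axiom of the latter (read in `L`
through `ι`) is a consequence of `T`. -/
def ExtendsRCF (T : L.Theory) : Prop :=
  ∀ σ ∈ RCF, T ⊨ᵇ ι.onSentence σ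

/-- `T` is model complete: every embedding between models of `T` is elementary. -/
def IsModelComplete (T : L.Theory) : Prop :=
  ∀ (M N : Theory.ModelType.{u, v, w} T) (f : M ↪[L] N) (n : ℕ) (φ : L.Formula (Fin n))
    (x : Fin n → M), φ.Realize (f ∘ x) ↔ φ.Realize x

/-- Open intervals with respect to a strict linear order, with endpoints in `M ∪ {±∞}`. -/
def IsOpenInterval {M : Type w} (lt : M → M → Prop) (I : Set M) : Prop :=
  (∃ a b, lt a b ∧ I = {x | lt a x ∧ lt x b}) ∨ (∃ a, I = {x | lt a x}) ∨
    (∃ b, I = {x | lt x b}) ∨ I = Set.univ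

/-- The interpretation of the symbol `<` in an `L`-structure. -/
def ltOf (M : Type w) [L.Structure M] (a b : M) : Prop :=
  Structure.RelMap (ι.onRelation ltSymb) ![a, b]

/-- An `L`-structure is o-minimal if each subset of it which is definable with parameters is a
finite union of points and open intervals. -/
def IsOMinimalStructure (M : Type w) [L.Structure M] : Prop :=
  ∀ S : Set M, (Set.univ : Set M).Definable₁ L S →
    ∃ F : Set (Set M), F.Finite ∧ (∀ I ∈ F, (∃ a, I = {a}) ∨ IsOpenInterval (ltOf ι M) I) ∧
      S = ⋃₀ F

/-- `T` is o-minimal: every model of `T` is o-minimal. -/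
def IsOMinimal (T : L.Theory) : Prop :=
  ∀ M : Theory.ModelType.{u, v, w} T, IsOMinimalStructure ι M

/-- The `L`-structure on the ordered field `K` interprets the symbols `0, 1, +, -, ·, <` in the
expected way. -/
structure IsCompatible (K : Type w) [Field K] [LinearOrder K] [L.Structure K] : Prop where
  zero : Structure.funMap (ι.onFunction (n := 0) Ring.zeroFunc) ![] = (0 : K)
  one : Structure.funMap (ι.onFunction (n := 0) Ring.oneFunc) ![] = (1 : K)
  add : ∀ a b : K, Structure.funMap (ι.onFunction (n := 2) Ring.addFunc) ![a, b] = a + b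
  neg : ∀ a : K, Structure.funMap (ι.onFunction (n := 1) Ring.negFunc) ![a] = -a
  mul : ∀ a b : K, Structure.funMap (ι.onFunction (n := 2) Ring.mulFunc) ![a, b] = a * b
  lt : ∀ a b : K, ltOf ι K a b ↔ a < b

end Theories

/-! ### Continuously differentiable functions and derivations -/

section Derivations

variable {K : Type w} [Field K] [TopologicalSpace K]

/-- `d` is the partial derivative of `F` at `u` with respect to the `i`-th coordinate. -/
def HasPartialDerivAt {n : ℕ} (F : (Fin n → K) → K) (i : Fin n) (u : Fin n → K) (d : K) : Prop :=
  Filter.Tendsto (fun h : K => (F (Function.update u i (u i + h)) - F u) / h)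
    (nhdsWithin 0 {0}ᶜ) (nhds d)

/-- `F` is a `C¹`-function on the open set `U` with Jacobian matrix (a row) `J`: the partial
derivatives of `F` exist on `U`, are given by `J`, and are continuous on `U`. Only the values of
`F` and `J` on `U` matter. -/
structure IsC1On {n : ℕ} (F : (Fin n → K) → K) (U : Set (Fin n → K))
    (J : (Fin n → K) → Fin n → K) : Prop where
  isOpen : IsOpen U
  hasPartialDerivAt : ∀ u ∈ U, ∀ i, HasPartialDerivAt F i u (J u i)
  continuousOn : ∀ i, ContinuousOn (fun u => J u i) U

/-- The graph of the restriction of `F` to `U`, as a subset of `K ^ (n + 1)`. -/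
def graphOn {n : ℕ} (F : (Fin n → K) → K) (U : Set (Fin n → K)) : Set (Fin (n + 1) → K) :=
  {y | Fin.init y ∈ U ∧ y (Fin.last n) = F (Fin.init y)}

/-- `D` is a `T`-derivation on the model `K` of `T` (a theory in the language `L`): it is compatible
with every `C¹`-function with open domain which is definable without parameters. -/
def IsTDerivation (L : FirstOrder.Language.{u, v}) [L.Structure K] (D : K → K) : Prop :=
  ∀ (n : ℕ) (U : Set (Fin n → K)) (F : (Fin n → K) → K) (J : (Fin n → K) → Fin n → K),
    (∅ : Set K).Definable L (graphOn F U) → IsC1On F U J →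
      ∀ u ∈ U, D (F u) = ∑ i, J u i * D (u i)

/-- The jet `(a, a', …, a⁽ʳ⁾)`. -/
def jet (D : K → K) (r : ℕ) (a : K) : Fin (r + 1) → K := fun i => D^[i] a

/-- The dimension of a definable set `A ⊆ K ^ n` (with `K` o-minimal): the largest `k` such that the
image of `A` under the projection to some `k` of the coordinates has nonempty interior in `K ^ k`.
It is `⊥` (that is, `-∞`) if `A` is empty. -/
noncomputable def odim {n : ℕ} (A : Set (Fin n → K)) : WithBot ℕ∞ :=
  ⨆ (k : ℕ) (e : Fin k ↪o Fin n) (_ : (interior ((fun x => x ∘ e) '' A)).Nonempty),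
    ((k : ℕ∞) : WithBot ℕ∞)

/-- `Z ⊆ K` is thin if for some `r` the `r`-jets of its elements lie in a subset of `K ^ (1 + r)` of
dimension at most `r` which is definable with parameters in the language `L`. -/
def IsThin (L : FirstOrder.Language.{u, v}) [L.Structure K] (D : K → K) (Z : Set K) : Prop :=
  ∃ (r : ℕ) (A : Set (Fin (r + 1) → K)), (Set.univ : Set K).Definable L A ∧
    odim A ≤ ((r : ℕ∞) : WithBot ℕ∞) ∧ jet D r '' Z ⊆ A

end Derivations

end TDeriv

namespace TDeriv

open FirstOrder FirstOrder.Language Set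

/-! ### Definable predicates on an o-minimal ordered field -/

section OMinimal

/-! Fix `t` with `D t ≠ 0`, let `c` be the midpoint of an interval `(a, b)` inside `I`, and suppose
that `A` witnesses thinness at order `r`. For small `s > 0`, every `c + ∑ q_i s t^i` with rational
`q_i` in `(0, 1)` lies in `(a, b)`. Rationals are constants for `D`, so its jet is `jet c + W q`,
where `W` is the Wronskian matrix of `s, s t, …, s t^r` (`jet_add_sum`). As `t` is not a constant,
`W` is invertible (`det_wronskianMatrix_ne_zero`). The preimage of `A` under `x ↦ jet c + W x` is
therefore definable with empty interior, yet it contains all rational points of the open unit cube.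

This contradicts o-minimality (`interior_nonempty_of_rat_mem`). The rationals need not be dense in
`K`, but they are infinite in number, and a definable set with infinitely many fibres with interior
has interior itself (`interior_nonempty_of_fibres`). That is proved without cell decomposition, from
suprema and one-sided germs of definable subsets of the line. -/

/-- The predicate `p` on `K ^ α` is definable with parameters. -/
def DefPred (L : FirstOrder.Language.{u, v}) {K : Type w} [L.Structure K] {α : Type}
    (p : (α → K) → Prop) : Prop :=
  (Set.univ : Set K).Definable L {x | p x}

/-- The function `f` on `K ^ α` is definable with parameters. -/
abbrev DefFun (L : FirstOrder.Language.{u, v}) {K : Type w} [L.Structure K] {α : Type}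
    (f : (α → K) → K) : Prop :=
  (Set.univ : Set K).DefinableFun L f

/-- An o-minimal structure on an ordered field in which the order and the field operations are
definable. -/
structure IsOMinimalField (L : FirstOrder.Language.{u, v}) (K : Type w) [Field K] [LinearOrder K]
    [L.Structure K] : Prop where
  lt : DefPred L (fun x : Fin 2 → K => x 0 < x 1)
  add : DefFun L (fun x : Fin 2 → K => x 0 + x 1)
  mul : DefFun L (fun x : Fin 2 → K => x 0 * x 1)
  omin : ∀ S : Set K, (Set.univ : Set K).Definable₁ L S →
    ∃ F : Set (Set K), F.Finite ∧
      (∀ I ∈ F, (∃ a, I = {a}) ∨ IsOpenInterval (fun a b : K => a < b) I) ∧ S = ⋃₀ F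

variable {L : FirstOrder.Language.{u, v}} {K : Type w} [L.Structure K] {α β : Type}

namespace DefPred

variable {p q : (α → K) → Prop}

theorem and (hp : DefPred L p) (hq : DefPred L q) : DefPred L (fun x => p x ∧ q x) :=
  Definable.inter hp hq

theorem or (hp : DefPred L p) (hq : DefPred L q) : DefPred L (fun x => p x ∨ q x) :=
  Definable.union hp hq

theorem not (hp : DefPred L p) : DefPred L (fun x => ¬ p x) :=
  Definable.compl hp

theorem imp (hp : DefPred L p) (hq : DefPred L q) : DefPred L (fun x => p x → q x) := by
  simpa only [imp_iff_not_or] using! or hp.not hq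

theorem subst [Finite β] {q : (β → K) → Prop} (hq : DefPred L q) {f : (α → K) → β → K}
    (hf : ∀ b, DefFun L (fun x => f x b)) : DefPred L (fun x => q (f x)) :=
  Definable.preimage_map (F := f) hf hq

theorem forall_fintype {ι : Type} [Finite ι] {p : ι → (α → K) → Prop}
    (hp : ∀ i, DefPred L (p i)) : DefPred L (fun x => ∀ i, p i x) := by
  have e : {x | ∀ i, p i x} = ⋂ i, {x | p i x} := by
    ext x
    simp
  rw [DefPred, e]
  exact definable_iInter_of_finite hp

theorem exists_fun [Finite β] {p : (α → K) → (β → K) → Prop}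
    (hp : DefPred L (fun x : α ⊕ β → K => p (fun a => x (Sum.inl a)) (fun b => x (Sum.inr b)))) :
    DefPred L (fun x => ∃ y, p x y) := by
  have := Definable.exists_of_finite hp
  simpa [DefPred] using this

theorem forall_fun [Finite β] {p : (α → K) → (β → K) → Prop}
    (hp : DefPred L (fun x : α ⊕ β → K => p (fun a => x (Sum.inl a)) (fun b => x (Sum.inr b)))) :
    DefPred L (fun x => ∀ y, p x y) := by
  have := Definable.forall_of_finite hp
  simpa [DefPred] using this

theorem exists_elem {p : (α → K) → K → Prop}
    (hp : DefPred L (fun x : α ⊕ Unit → K => p (fun a => x (Sum.inl a)) (x (Sum.inr ())))) :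
    DefPred L (fun x => ∃ y, p x y) := by
  have := exists_fun (β := Unit) (p := fun x y => p x (y ())) hp
  convert this using 2 with x
  exact ⟨fun ⟨y, hy⟩ => ⟨fun _ => y, hy⟩, fun ⟨y, hy⟩ => ⟨y (), hy⟩⟩

theorem forall_elem {p : (α → K) → K → Prop}
    (hp : DefPred L (fun x : α ⊕ Unit → K => p (fun a => x (Sum.inl a)) (x (Sum.inr ())))) :
    DefPred L (fun x => ∀ y, p x y) := by
  have := forall_fun (β := Unit) (p := fun x y => p x (y ())) hp
  convert this using 2 with x
  exact ⟨fun h y => h _, fun h y => h fun _ => y⟩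

end DefPred

theorem DefFun.coord (a : α) : DefFun L (fun x : α → K => x a) :=
  DefinableFun.proj L

theorem DefFun.const (c : K) : DefFun L (fun _ : α → K => c) :=
  L.definableFun_const α (mem_univ c)

/-- A subset of `K` is definable with parameters. -/
def DefSet (L : FirstOrder.Language.{u, v}) {K : Type w} [L.Structure K] (S : Set K) : Prop :=
  DefPred L (fun x : Unit → K => x () ∈ S)

namespace IsOMinimalField

variable [Field K] [LinearOrder K] (h : IsOMinimalField L K) {f g : (α → K) → K}

include h

theorem defFun_add (hf : DefFun L f) (hg : DefFun L g) : DefFun L (fun x => f x + g x) :=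
  DefinableFun.comp (g := fun x => ![f x, g x]) (f := fun x : Fin 2 → K => x 0 + x 1)
    (by intro i; fin_cases i <;> assumption) h.add

theorem defFun_mul (hf : DefFun L f) (hg : DefFun L g) : DefFun L (fun x => f x * g x) :=
  DefinableFun.comp (g := fun x => ![f x, g x]) (f := fun x : Fin 2 → K => x 0 * x 1)
    (by intro i; fin_cases i <;> assumption) h.mul

theorem defFun_sum {ι : Type} (s : Finset ι) {f : ι → (α → K) → K} (hf : ∀ i, DefFun L (f i)) :
    DefFun L (fun x => ∑ i ∈ s, f i x) := by
  classical
  induction s using Finset.induction_on with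
  | empty => simpa using DefFun.const 0
  | insert i s hi ih =>
    simp only [Finset.sum_insert hi]
    exact h.defFun_add (hf i) ih

theorem defPred_lt (hf : DefFun L f) (hg : DefFun L g) : DefPred L (fun x => f x < g x) :=
  DefPred.subst (f := fun x => ![f x, g x]) h.lt (by intro i; fin_cases i <;> assumption)

theorem defPred_le (hf : DefFun L f) (hg : DefFun L g) : DefPred L (fun x => f x ≤ g x) := by
  simpa only [not_lt] using (h.defPred_lt hg hf).not

theorem exists_finite_decomp {S : Set K} (hS : DefSet L S) : ∃ F : Set (Set K), F.Finite ∧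
    (∀ I ∈ F, (∃ a, I = {a}) ∨ IsOpenInterval (fun a b : K => a < b) I) ∧ S = ⋃₀ F :=
  h.omin S (DefPred.subst (f := fun (x : Fin 1 → K) (_ : Unit) => x 0) hS
    (fun _ => DefFun.coord 0))

omit h
variable [IsStrictOrderedRing K]

omit [L.Structure K] in
theorem _root_.TDeriv.IsOpenInterval.exists_Ioo {I : Set K}
    (hI : IsOpenInterval (fun a b : K => a < b) I) : ∃ a b, a < b ∧ Ioo a b ⊆ I := by
  obtain ⟨a, b, hab, rfl⟩ | ⟨a, rfl⟩ | ⟨b, rfl⟩ | rfl := hI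
  · exact ⟨a, b, hab, fun x hx => hx⟩
  · exact ⟨a, a + 1, by simp, fun x hx => hx.1⟩
  · exact ⟨b - 1, b, by simp, fun x hx => hx.2⟩
  · exact ⟨0, 1, by simp, fun x hx => trivial⟩

include h

theorem exists_Ioo_of_infinite {S : Set K} (hS : DefSet L S) (hinf : S.Infinite) :
    ∃ a b, a < b ∧ Ioo a b ⊆ S := by
  obtain ⟨F, hF, hF', rfl⟩ := h.exists_finite_decomp hS
  by_contra hcon
  refine hinf (hF.sUnion fun I hI => ?_)
  obtain ⟨a, rfl⟩ | hI' := hF' I hI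
  · simp
  · obtain ⟨a, b, hab, hs⟩ := hI'.exists_Ioo
    exact absurd ⟨a, b, hab, hs.trans (subset_sUnion_of_mem hI)⟩ hcon

/-- Definable completeness, standing in for Dedekind completeness: each piece of the finite
decomposition has a supremum, and the largest of these works. -/
theorem exists_isLUB {S : Set K} (hS : DefSet L S) (hne : S.Nonempty) (hb : BddAbove S) :
    ∃ s, IsLUB S s := by
  obtain ⟨F, hF, hF', rfl⟩ := h.exists_finite_decomp hS
  clear hS
  induction F, hF using Set.Finite.induction_on with
  | empty => simp at hne
  | @insert I F _ _ ih =>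
    rw [sUnion_insert] at hb ⊢
    have hI : ∃ s, IsLUB I s := by
      have hbI : BddAbove I := hb.mono subset_union_left
      obtain ⟨a, rfl⟩ | ⟨a, b, hab, rfl⟩ | ⟨a, rfl⟩ | ⟨b, rfl⟩ | rfl := hF' I (mem_insert _ _)
      · exact ⟨a, isLUB_singleton⟩
      · exact ⟨b, isLUB_Ioo hab⟩
      · exact absurd hbI (not_bddAbove_Ioi a)
      · exact ⟨b, isLUB_Iio⟩
      · exact absurd hbI not_bddAbove_univ
    obtain ⟨s, hs⟩ := hI
    rcases (⋃₀ F).eq_empty_or_nonempty with he | hne'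
    · exact ⟨s, by rwa [he, union_empty]⟩
    · obtain ⟨t, ht⟩ := ih (fun I hI => hF' I (mem_insert_of_mem _ hI)) hne'
        (hb.mono subset_union_right)
      exact ⟨_, hs.union ht⟩

/-- A point or an interval either contains or misses a right neighbourhood of `a`, and finite unions
inherit the dichotomy. It turns "not eventually" into "eventually not". -/
theorem right_germ {S : Set K} (hS : DefSet L S) (a : K) :
    (∃ b, a < b ∧ Ioo a b ⊆ S) ∨ ∃ b, a < b ∧ Ioo a b ⊆ Sᶜ := by
  obtain ⟨F, hF, hF', rfl⟩ := h.exists_finite_decomp hS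
  clear hS
  induction F, hF using Set.Finite.induction_on with
  | empty => exact Or.inr ⟨a + 1, by simp, by simp⟩
  | @insert I F _ _ ih =>
    have hI : (∃ b, a < b ∧ Ioo a b ⊆ I) ∨ ∃ b, a < b ∧ Ioo a b ⊆ Iᶜ := by
      obtain ⟨c, rfl⟩ | ⟨c, d, hcd, rfl⟩ | ⟨c, rfl⟩ | ⟨d, rfl⟩ | rfl := hF' I (mem_insert _ _)
      · rcases lt_or_ge a c with hac | hac
        · exact Or.inr ⟨c, hac, fun x hx hxc => hx.2.ne hxc⟩
        · exact Or.inr ⟨a + 1, by simp, fun x hx hxc => (hac.trans_lt hx.1).ne' hxc⟩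
      · rcases lt_or_ge a c with hac | hac
        · exact Or.inr ⟨c, hac, fun x hx hxc => lt_asymm hx.2 hxc.1⟩
        · rcases lt_or_ge a d with had | had
          · exact Or.inl ⟨d, had, fun x hx => ⟨hac.trans_lt hx.1, hx.2⟩⟩
          · exact Or.inr ⟨a + 1, by simp, fun x hx hxc => lt_asymm hxc.2 (had.trans_lt hx.1)⟩
      · rcases lt_or_ge a c with hac | hac
        · exact Or.inr ⟨c, hac, fun x hx hxc => lt_asymm hx.2 hxc⟩
        · exact Or.inl ⟨a + 1, by simp, fun x hx => hac.trans_lt hx.1⟩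
      · rcases lt_or_ge a d with had | had
        · exact Or.inl ⟨d, had, fun x hx => hx.2⟩
        · exact Or.inr ⟨a + 1, by simp, fun x hx hxc => lt_asymm hxc (had.trans_lt hx.1)⟩
      · exact Or.inl ⟨a + 1, by simp, fun _ _ => trivial⟩
    rw [sUnion_insert]
    obtain ⟨b, hab, hb⟩ | ⟨b, hab, hb⟩ := hI
    · exact Or.inl ⟨b, hab, hb.trans subset_union_left⟩
    · obtain ⟨c, hac, hc⟩ | ⟨c, hac, hc⟩ := ih fun I hI => hF' I (mem_insert_of_mem _ hI)
      · exact Or.inl ⟨c, hac, hc.trans subset_union_right⟩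
      · refine Or.inr ⟨min b c, lt_min hab hac, fun x hx => ?_⟩
        have hx' := lt_min_iff.1 hx.2
        rw [compl_union]
        exact ⟨hb ⟨hx.1, hx'.1⟩, hc ⟨hx.1, hx'.2⟩⟩

end IsOMinimalField

end OMinimal

end TDeriv

namespace TDeriv

open FirstOrder FirstOrder.Language Set

/-! ### Uniformity in definable families over an interval -/

section Fibres

variable {L : FirstOrder.Language.{u, v}} {K : Type w} [L.Structure K] {α β : Type}

theorem DefPred.subst₂ {P : K → K → Prop} (hP : DefPred L (fun z : Fin 2 → K => P (z 0) (z 1)))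
    {f g : (α → K) → K} (hf : DefFun L f) (hg : DefFun L g) :
    DefPred L (fun x => P (f x) (g x)) :=
  DefPred.subst (f := fun x => ![f x, g x]) hP (by intro i; fin_cases i <;> assumption)

theorem DefPred.substOption [Finite β] {R : K → (β → K) → Prop}
    (hR : DefPred L (fun z : Option β → K => R (z none) (fun b => z (some b))))
    {f : (α → K) → K} {g : (α → K) → β → K} (hf : DefFun L f)
    (hg : ∀ b, DefFun L (fun x => g x b)) : DefPred L (fun x => R (f x) (g x)) :=
  DefPred.subst (f := fun x (i : Option β) => i.elim (f x) (g x)) hR (by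
    rintro (_ | i)
    · exact hf
    · exact hg i)

namespace IsOMinimalField

variable [Field K] [LinearOrder K] [IsStrictOrderedRing K] (h : IsOMinimalField L K)

include h

/-- Elements of the fibres of a definable set with bounded nonempty fibres can be chosen almost
constant near a given point. -/
theorem exists_approx {P : K → K → Prop}
    (hP : DefPred L (fun z : Fin 2 → K => P (z 0) (z 1))) {a b M ε : K} (hab : a < b)
    (hne : ∀ x ∈ Ioo a b, ∃ y, P x y) (hbd : ∀ x ∈ Ioo a b, ∀ y, P x y → |y| ≤ M) (hε : 0 < ε) :
    ∃ c l, a < c ∧ c ≤ b ∧ ∀ x ∈ Ioo a c, ∃ y, P x y ∧ |y - l| ≤ ε := by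
  -- The supremum `l` of `S` acts as the lower limit, as `x` tends to `a` from the right, of the
  -- infima of the fibres.
  let S : Set K := {y | ¬ ∃ c, a < c ∧ ∀ x, (a < x ∧ x < c) → ∃ z, P x z ∧ z ≤ y}
  have hS : DefSet L S := by
    refine DefPred.not (DefPred.exists_elem (DefPred.and ?_ (DefPred.forall_elem
      (DefPred.imp (DefPred.and ?_ ?_) (DefPred.exists_elem (DefPred.and ?_ ?_))))))
    · exact h.defPred_lt (DefFun.const _) (DefFun.coord _)
    · exact h.defPred_lt (DefFun.const _) (DefFun.coord _)
    · exact h.defPred_lt (DefFun.coord _) (DefFun.coord _)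
    · exact hP.subst₂ (DefFun.coord _) (DefFun.coord _)
    · exact h.defPred_le (DefFun.coord _) (DefFun.coord _)
  have hSne : S.Nonempty := by
    refine ⟨-M - 1, ?_⟩
    rintro ⟨c, hac, hc⟩
    obtain ⟨x, hax, hx⟩ := exists_between (lt_min hac hab)
    obtain ⟨hxc, hxb⟩ := lt_min_iff.1 hx
    obtain ⟨z, hz, hz'⟩ := hc x ⟨hax, hxc⟩
    have := (abs_le.1 (hbd x ⟨hax, hxb⟩ z hz)).1
    linarith
  have hSb : BddAbove S := by
    refine ⟨M, fun y hy => not_lt.1 fun hMy => hy ⟨b, hab, fun x hx => ?_⟩⟩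
    obtain ⟨z, hz⟩ := hne x hx
    exact ⟨z, hz, ((le_abs_self z).trans (hbd x hx z hz)).trans hMy.le⟩
  obtain ⟨l, hl⟩ := h.exists_isLUB hS hSne hSb
  have h1 : l + ε ∉ S := fun hs => by
    have := hl.1 hs
    linarith
  obtain ⟨c, hac, hc⟩ := not_not.1 h1
  obtain ⟨y, hy, hly, -⟩ := hl.exists_between (show l - ε < l by linarith)
  -- Since `y ∈ S`, fibres do not eventually meet `(-∞, y]`. By `right_germ` they eventually avoid
  -- it, so points found below `l + ε` are also above `l - ε`.
  have hG : DefSet L {x | ∃ z, P x z ∧ z ≤ y} := by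
    refine DefPred.exists_elem (DefPred.and ?_ ?_)
    · exact hP.subst₂ (DefFun.coord _) (DefFun.coord _)
    · exact h.defPred_le (DefFun.coord _) (DefFun.const _)
  obtain ⟨d, had, hd⟩ | ⟨d, had, hd⟩ := h.right_germ hG a
  · exact absurd ⟨d, had, fun x hx => hd hx⟩ hy
  · refine ⟨min b (min c d), l, lt_min hab (lt_min hac had), min_le_left _ _, fun x hx => ?_⟩
    obtain ⟨-, hx'⟩ := lt_min_iff.1 hx.2
    obtain ⟨hxc, hxd⟩ := lt_min_iff.1 hx'
    obtain ⟨z, hz, hzl⟩ := hc x ⟨hx.1, hxc⟩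
    refine ⟨z, hz, abs_le.2 ⟨?_, by linarith⟩⟩
    have : ¬ z ≤ y := fun hzy => hd ⟨hx.1, hxd⟩ ⟨z, hz, hzy⟩
    linarith [not_le.1 this]

theorem defPred_abs_sub_le {f g : (α → K) → K} (hf : DefFun L f) (hg : DefFun L g) (c : K) :
    DefPred L (fun x => |f x - g x| ≤ c) := by
  have : DefPred L (fun x => f x ≤ c + g x ∧ g x ≤ c + f x) :=
    (h.defPred_le hf (h.defFun_add (DefFun.const c) hg)).and
      (h.defPred_le hg (h.defFun_add (DefFun.const c) hf))
  convert this using 2 with x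
  rw [abs_le]
  constructor <;> rintro ⟨_, _⟩ <;> constructor <;> linarith

/-- The many-dimensional version of `exists_approx`. -/
theorem exists_approx_pi [Finite β] {R : K → (β → K) → Prop}
    (hR : DefPred L (fun z : Option β → K => R (z none) (fun b => z (some b))))
    {a b M ε : K} (hab : a < b) (hne : ∀ x ∈ Ioo a b, ∃ y, R x y)
    (hbd : ∀ x ∈ Ioo a b, ∀ y, R x y → ∀ i, |y i| ≤ M) (hε : 0 < ε) :
    ∃ (c : K) (l : β → K), a < c ∧ c ≤ b ∧ ∀ x ∈ Ioo a c, ∃ y, R x y ∧ ∀ i, |y i - l i| ≤ ε := by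
  classical
  cases nonempty_fintype β
  suffices H : ∀ s : Finset β, ∃ (c : K) (l : β → K), a < c ∧ c ≤ b ∧ ∀ x ∈ Ioo a c,
      ∃ y, R x y ∧ ∀ i, i ∈ s → |y i - l i| ≤ ε by
    simpa using H Finset.univ
  intro s
  induction s using Finset.induction_on with
  | empty => exact ⟨b, 0, hab, le_rfl, fun x hx => by simpa using hne x hx⟩
  | insert j s hj ih =>
    obtain ⟨c, l, hac, hcb, hc⟩ := ih
    -- The possible `j`-th coordinates of points already controlled on `s`. The condition `|y j - t|
    -- ≤ 0` is equality in a form covered by `defPred_abs_sub_le`.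
    let P : K → K → Prop := fun x t =>
      ∃ y : β → K, (R x y ∧ ∀ i, i ∈ s → |y i - l i| ≤ ε) ∧ |y j - t| ≤ 0
    have hP : DefPred L (fun z : Fin 2 → K => P (z 0) (z 1)) := by
      refine DefPred.exists_fun (DefPred.and (DefPred.and ?_ (DefPred.forall_fintype fun i => ?_))
        ?_)
      · exact hR.substOption (DefFun.coord _) fun _ => DefFun.coord _
      · by_cases hi : i ∈ s
        · simpa [hi] using h.defPred_abs_sub_le (DefFun.coord _) (DefFun.const _) ε
        · simp [hi, DefPred]
      · exact h.defPred_abs_sub_le (DefFun.coord _) (DefFun.coord _) 0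
    obtain ⟨d, t, had, hdc, hd⟩ := h.exists_approx hP (M := M) hac
      (fun x hx => by
        obtain ⟨y, hy⟩ := hc x hx
        exact ⟨y j, y, hy, by simp⟩)
      (fun x hx t ⟨y, hy, hyt⟩ => by
        have : y j = t := by simpa [sub_eq_zero] using hyt
        exact this ▸ hbd x ⟨hx.1, hx.2.trans_le hcb⟩ y hy.1 j) hε
    refine ⟨d, Function.update l j t, had, hdc.trans hcb, fun x hx => ?_⟩
    obtain ⟨t', ⟨y, hy, hyt⟩, ht'⟩ := hd x hx
    have hyt' : y j = t' := by simpa [sub_eq_zero] using hyt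
    refine ⟨y, hy.1, fun i hi => ?_⟩
    by_cases hij : i = j
    · subst hij
      simpa [hyt'] using ht'
    · simpa [hij] using hy.2 i (Finset.mem_of_mem_insert_of_ne hi hij)

/-- If an interval is covered by a definable increasing family of sets, then one of them is
infinite. -/
theorem exists_infinite_of_cover {E : K → K → Prop}
    (hE : DefPred L (fun z : Fin 2 → K => E (z 0) (z 1)))
    (hanti : ∀ x δ ε, 0 < δ → δ ≤ ε → E x ε → E x δ) {a b : K} (hab : a < b)
    (hcov : ∀ x ∈ Ioo a b, ∃ ε, 0 < ε ∧ E x ε) : ∃ ε, 0 < ε ∧ {x ∈ Ioo a b | E x ε}.Infinite := by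
  by_contra! hfin
  let Q : K → K → Prop := fun x ε => (0 < ε ∧ ε ≤ 1) ∧ E x ε
  -- `B x s` says that `s` is the supremum of the admissible `ε ≤ 1` at `x`; `V` collects these
  -- suprema.
  let B : K → K → Prop := fun x s =>
    (∀ ε, Q x ε → ε ≤ s) ∧ ∀ t, t < s → ∃ ε, Q x ε ∧ t < ε
  let V : Set K := {s | ∃ x, (a < x ∧ x < b) ∧ B x s}
  have hQ : DefPred L (fun z : Fin 2 → K => Q (z 0) (z 1)) := by
    refine DefPred.and (DefPred.and ?_ ?_) hE
    · exact h.defPred_lt (DefFun.const _) (DefFun.coord _)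
    · exact h.defPred_le (DefFun.coord _) (DefFun.const _)
  have hV : DefSet L V := by
    refine DefPred.exists_elem (DefPred.and (DefPred.and ?_ ?_) (DefPred.and
      (DefPred.forall_elem (DefPred.imp ?_ ?_)) (DefPred.forall_elem (DefPred.imp ?_
        (DefPred.exists_elem (DefPred.and ?_ ?_))))))
    · exact h.defPred_lt (DefFun.const _) (DefFun.coord _)
    · exact h.defPred_lt (DefFun.coord _) (DefFun.const _)
    · exact hQ.subst₂ (DefFun.coord _) (DefFun.coord _)
    · exact h.defPred_le (DefFun.coord _) (DefFun.coord _)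
    · exact h.defPred_lt (DefFun.coord _) (DefFun.coord _)
    · exact hQ.subst₂ (DefFun.coord _) (DefFun.coord _)
    · exact h.defPred_lt (DefFun.coord _) (DefFun.coord _)
  have hQne : ∀ x ∈ Ioo a b, ∃ ε, Q x ε := fun x hx => by
    obtain ⟨ε, hε, hx'⟩ := hcov x hx
    exact ⟨min ε 1, ⟨lt_min hε one_pos, min_le_right _ _⟩,
      hanti _ _ _ (lt_min hε one_pos) (min_le_left _ _) hx'⟩
  have hBex : ∀ x ∈ Ioo a b, ∃ s, B x s := fun x hx => by
    have hQx : DefSet L {ε | Q x ε} := hQ.subst₂ (DefFun.const _) (DefFun.coord _)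
    obtain ⟨s, hs⟩ := h.exists_isLUB hQx (hQne x hx) ⟨1, fun ε hε => hε.1.2⟩
    refine ⟨s, fun ε hε => hs.1 hε, fun t ht => ?_⟩
    obtain ⟨ε, hε, hε', -⟩ := hs.exists_between ht
    exact ⟨ε, hε, hε'⟩
  have hBE : ∀ x s t, B x s → 0 < t → t < s → E x t := fun x s t hB ht hts => by
    obtain ⟨ε, hε, htε⟩ := hB.2 t hts
    exact hanti _ _ _ ht htε.le hε.2
  have hVpos : ∀ s ∈ V, 0 < s := fun s ⟨x, hx, hB⟩ => by
    obtain ⟨ε, hε⟩ := hQne x hx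
    exact hε.1.1.trans_le (hB.1 ε hε)
  -- Were `V` finite, `(a, b)` would be a finite union of the sets where `E x (s / 2)` holds, each
  -- assumed finite.
  have hVinf : V.Infinite := fun hVfin => by
    have hsub : Ioo a b ⊆ ⋃ s ∈ V, {x ∈ Ioo a b | E x (s / 2)} := fun x hx => by
      obtain ⟨s, hs⟩ := hBex x hx
      have hsV : s ∈ V := ⟨x, hx, hs⟩
      have hs0 := hVpos s hsV
      exact mem_biUnion hsV ⟨hx, hBE x s _ hs (half_pos hs0) (half_lt_self hs0)⟩
    exact Ioo_infinite hab ((hVfin.biUnion fun s hs => hfin _ (half_pos (hVpos s hs))).subset hsub)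
  obtain ⟨c, d, hcd, hV'⟩ := h.exists_Ioo_of_infinite hV hVinf
  obtain ⟨e, hce, hed⟩ := exists_between hcd
  have he : 0 < e := hVpos e (hV' ⟨hce, hed⟩)
  -- Distinct suprema come from distinct points, and each supremum above `e` gives `E x e`:
  -- infinitely many such `x`.
  choose! f hf using fun s (hs : s ∈ Ioo e d) => hV' ⟨hce.trans hs.1, hs.2⟩
  have hinj : InjOn f (Ioo e d) := by
    have key : ∀ s ∈ Ioo e d, ∀ t ∈ Ioo e d, f s = f t → ¬ s < t := fun s hs t ht hst hlt => by
      obtain ⟨ε, hε, hsε⟩ := (hf t ht).2.2 s hlt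
      rw [← hst] at hε
      exact hsε.not_ge ((hf s hs).2.1 ε hε)
    intro s hs t ht hst
    exact le_antisymm (not_lt.1 (key t ht s hs hst.symm)) (not_lt.1 (key s hs t ht hst))
  refine (Ioo_infinite hed).image hinj ((hfin e he).subset ?_)
  rintro _ ⟨s, hs, rfl⟩
  exact ⟨(hf s hs).1, hBE _ s e (hf s hs).2 he hs.1⟩

end IsOMinimalField

end Fibres

end TDeriv

namespace TDeriv

open FirstOrder FirstOrder.Language Set

/-! ### Interior of definable sets from their fibres -/

section Interior

variable {K : Type w} [Field K] [LinearOrder K] [IsStrictOrderedRing K] [TopologicalSpace K]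
  [OrderTopology K]

theorem exists_cube_of_interior_nonempty {β : Type} [Finite β] {B : Set (β → K)}
    (hB : (interior B).Nonempty) :
    ∃ (ε : K) (c : β → K), 0 < ε ∧ ∀ y, (∀ i, |y i - c i| ≤ ε) → y ∈ B := by
  cases nonempty_fintype β
  obtain ⟨c, hc⟩ := hB
  rw [mem_interior_iff_mem_nhds, nhds_pi, Filter.mem_pi'] at hc
  obtain ⟨I, t, ht, hI⟩ := hc
  have hex : ∀ i, ∃ ε : K, 0 < ε ∧ ∀ y, |y - c i| < ε → y ∈ t i := fun i =>
    (nhds_basis_abs_sub_lt (c i)).mem_iff.1 (ht i)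
  choose e he het using hex
  obtain ⟨ε, hε, hεe⟩ : ∃ ε : K, 0 < ε ∧ ∀ i, ε < e i := by
    rcases isEmpty_or_nonempty β with hβ | hβ
    · exact ⟨1, one_pos, fun i => hβ.elim i⟩
    · obtain ⟨j, hj⟩ := Finite.exists_min e
      exact ⟨e j / 2, half_pos (he j), fun i => (half_lt_self (he j)).trans_le (hj i)⟩
  exact ⟨ε, c, hε, fun y hy => hI fun i _ => het i _ ((hy i).trans_lt (hεe i))⟩

theorem isOpen_abs_sub_lt (c ε : K) : IsOpen {x : K | |x - c| < ε} := by
  simp only [abs_lt, sub_lt_iff_lt_add, lt_sub_iff_add_lt]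
  exact (isOpen_lt' (a := -ε + c)).inter (isOpen_gt' (a := ε + c))

variable {L : FirstOrder.Language.{u, v}} [L.Structure K] (h : IsOMinimalField L K)

include h

/-- If infinitely many fibres of a definable set have nonempty interior, then so does the set. -/
theorem IsOMinimalField.interior_nonempty_of_fibres {n : ℕ} {B : Set (Fin (n + 1) → K)}
    (hB : DefPred L (fun x => x ∈ B))
    (hinf : {x : K | (interior {y : Fin n → K | Fin.cons x y ∈ B}).Nonempty}.Infinite) :
    (interior B).Nonempty := by
  -- A cube of radius `ε` around `c` lies in the fibre, and `|ε * c i| ≤ 1`. Thus one parameter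
  -- controls both the radius and the size of the centre, as `exists_approx_pi` needs bounded
  -- fibres.
  let R : K → K → (Fin n → K) → Prop := fun ε x c =>
    (∀ i, ε * c i ≤ 1 ∧ -1 ≤ ε * c i) ∧
      ∀ y : Fin n → K, (∀ i, y i ≤ c i + ε ∧ c i ≤ y i + ε) → Fin.cons x y ∈ B
  have hR : DefPred L (fun z : Option (Option (Fin n)) → K =>
      R (z none) (z (some none)) (fun i => z (some (some i)))) := by
    refine DefPred.and (DefPred.forall_fintype fun i => DefPred.and ?_ ?_)
      (DefPred.forall_fun (DefPred.imp (DefPred.forall_fintype fun i => DefPred.and ?_ ?_) ?_))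
    · exact h.defPred_le (h.defFun_mul (DefFun.coord _) (DefFun.coord _)) (DefFun.const _)
    · exact h.defPred_le (DefFun.const _) (h.defFun_mul (DefFun.coord _) (DefFun.coord _))
    · exact h.defPred_le (DefFun.coord _) (h.defFun_add (DefFun.coord _) (DefFun.coord _))
    · exact h.defPred_le (DefFun.coord _) (h.defFun_add (DefFun.coord _) (DefFun.coord _))
    · refine DefPred.subst hB fun i => ?_
      refine Fin.cases ?_ (fun j => ?_) i
      · simpa only [Fin.cons_zero] using DefFun.coord _
      · simpa only [Fin.cons_succ] using DefFun.coord _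
  have hRε : ∀ ε, DefPred L (fun z : Option (Fin n) → K =>
      R ε (z none) (fun i => z (some i))) := fun ε =>
    DefPred.subst (f := fun (z : Option (Fin n) → K) (i : Option (Option (Fin n))) => i.elim ε z) hR
      (by
        rintro (_ | i)
        · exact DefFun.const _
        · exact DefFun.coord _)
  let E : K → K → Prop := fun x ε => 0 < ε ∧ ∃ c, R ε x c
  have hE : DefPred L (fun z : Fin 2 → K => E (z 0) (z 1)) := by
    refine DefPred.and (h.defPred_lt (DefFun.const _) (DefFun.coord _)) (DefPred.exists_fun ?_)
    refine DefPred.subst (f := fun (z : Fin 2 ⊕ Fin n → K) (i : Option (Option (Fin n))) =>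
      i.elim (z (Sum.inl 1)) fun j => j.elim (z (Sum.inl 0)) fun k => z (Sum.inr k)) hR ?_
    rintro (_ | _ | i) <;> exact DefFun.coord _
  have hmono : ∀ x δ ε, 0 < δ → δ ≤ ε → E x ε → E x δ := by
    rintro x δ ε hδ hδε ⟨hε, c, hc, hcB⟩
    refine ⟨hδ, c, fun i => ?_, fun y hy => hcB y fun i => ?_⟩
    · have h1 : |ε * c i| ≤ 1 := abs_le.2 ⟨(hc i).2, (hc i).1⟩
      have h2 : |δ * c i| ≤ 1 := by
        refine le_trans ?_ h1
        rw [abs_mul, abs_mul, abs_of_pos hδ, abs_of_pos hε]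
        exact mul_le_mul_of_nonneg_right hδε (abs_nonneg _)
      exact ⟨(abs_le.1 h2).2, (abs_le.1 h2).1⟩
    · exact ⟨(hy i).1.trans (by gcongr), (hy i).2.trans (by gcongr)⟩
  have hEint : ∀ x, (interior {y : Fin n → K | Fin.cons x y ∈ B}).Nonempty → ∃ ε, 0 < ε ∧ E x ε := by
    intro x hx
    obtain ⟨ε, c, hε, hc⟩ := exists_cube_of_interior_nonempty hx
    obtain ⟨M, hM1, hM⟩ : ∃ M : K, 1 ≤ M ∧ ∀ i, |c i| ≤ M := by
      refine ⟨1 + ∑ i, |c i|, by simpa using Finset.sum_nonneg fun i _ => abs_nonneg (c i),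
        fun i => ?_⟩
      have := Finset.single_le_sum (f := fun i => |c i|) (fun i _ => abs_nonneg (c i))
        (Finset.mem_univ i)
      linarith
    have hM0 : 0 < M := one_pos.trans_le hM1
    have hδ : 0 < min ε M⁻¹ := lt_min hε (inv_pos.2 hM0)
    refine ⟨min ε M⁻¹, hδ, hδ, c, fun i => ?_, fun y hy => hc y fun i => ?_⟩
    · have : |min ε M⁻¹ * c i| ≤ 1 := by
        rw [abs_mul, abs_of_pos hδ]
        calc min ε M⁻¹ * |c i| ≤ M⁻¹ * M :=
              mul_le_mul (min_le_right _ _) (hM i) (abs_nonneg _) (inv_nonneg.2 hM0.le)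
          _ = 1 := inv_mul_cancel₀ hM0.ne'
      exact ⟨(abs_le.1 this).2, (abs_le.1 this).1⟩
    · have := min_le_left ε M⁻¹
      obtain ⟨h1, h2⟩ := hy i
      exact abs_le.2 ⟨by linarith, by linarith⟩
  have hX : DefSet L {x | ∃ ε, 0 < ε ∧ E x ε} := by
    refine DefPred.exists_elem (DefPred.and ?_ ?_)
    · exact h.defPred_lt (DefFun.const _) (DefFun.coord _)
    · exact hE.subst₂ (DefFun.coord _) (DefFun.coord _)
  obtain ⟨a, b, hab, hsub⟩ := h.exists_Ioo_of_infinite hX (hinf.mono hEint)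
  obtain ⟨ε, hε, hEinf⟩ := h.exists_infinite_of_cover hE hmono hab hsub
  have hX' : DefSet L {x ∈ Ioo a b | E x ε} := by
    refine DefPred.and (DefPred.and ?_ ?_) ?_
    · exact h.defPred_lt (DefFun.const _) (DefFun.coord _)
    · exact h.defPred_lt (DefFun.coord _) (DefFun.const _)
    · exact hE.subst₂ (DefFun.coord _) (DefFun.const _)
  obtain ⟨a', b', hab', hsub'⟩ := h.exists_Ioo_of_infinite hX' hEinf
  -- Centres within `ε / 2` of a fixed `l` make the radius `ε / 2` cube about `l` common to all
  -- fibres over `(a', d)`.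
  obtain ⟨d, l, had, -, hd⟩ := h.exists_approx_pi (hRε ε) (M := ε⁻¹) hab'
    (fun x hx => (hsub' hx).2.2)
    (fun x hx y hy i => by
      have h1 : |ε * y i| ≤ 1 := abs_le.2 ⟨(hy.1 i).2, (hy.1 i).1⟩
      rwa [abs_mul, abs_of_pos hε, ← le_inv_mul_iff₀ hε, mul_one] at h1) (half_pos hε)
  obtain ⟨x₀, hx₀⟩ := exists_between had
  refine ⟨Fin.cons x₀ l, mem_interior.2
    ⟨{z | z 0 ∈ Ioo a' d} ∩ ⋂ i : Fin n, {z | |z i.succ - l i| < ε / 2}, ?_, ?_, ?_⟩⟩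
  · rintro z ⟨hz0, hz⟩
    obtain ⟨c, hc, hcl⟩ := hd _ hz0
    have := hc.2 (fun i => z i.succ) fun i => by
      have h1 := abs_lt.1 (mem_iInter.1 hz i)
      have h2 := abs_le.1 (hcl i)
      constructor <;> linarith [h1.1, h1.2, h2.1, h2.2]
    rwa [show (Fin.cons (z 0) fun i => z i.succ : Fin (n + 1) → K) = z from Fin.cons_self_tail z]
      at this
  · exact (isOpen_Ioo.preimage (continuous_apply 0)).inter (isOpen_iInter_of_finite fun i =>
      (isOpen_abs_sub_lt (l i) (ε / 2)).preimage
        (continuous_apply (A := fun _ : Fin (n + 1) => K) i.succ))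
  · exact ⟨hx₀, mem_iInter.2 fun i => by simpa using half_pos hε⟩

/-- A definable set which contains all points with rational coordinates in `(0, 1)` has nonempty
interior. -/
theorem IsOMinimalField.interior_nonempty_of_rat_mem {n : ℕ} {B : Set (Fin n → K)}
    (hB : DefPred L (fun x => x ∈ B))
    (hrat : ∀ q : Fin n → ℚ, (∀ i, q i ∈ Ioo (0 : ℚ) 1) → (fun i => (q i : K)) ∈ B) :
    (interior B).Nonempty := by
  induction n with
  | zero =>
    have : B = univ := eq_univ_of_forall fun x => by
      simpa [Subsingleton.elim (fun i => ((Fin.elim0 i : ℚ) : K)) x] using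
        hrat (fun i => Fin.elim0 i) fun i => Fin.elim0 i
    simp [this]
  | succ n ih =>
    refine h.interior_nonempty_of_fibres hB ?_
    have hinf : ((fun q : ℚ => (q : K)) '' Ioo (0 : ℚ) 1).Infinite :=
      (Ioo_infinite one_pos).image Rat.cast_injective.injOn
    refine hinf.mono ?_
    rintro _ ⟨q, hq, rfl⟩
    refine ih ?_ fun p hp => ?_
    · refine DefPred.subst hB (f := fun y : Fin n → K => (Fin.cons (q : K) y : Fin (n + 1) → K))
        fun i => ?_
      refine Fin.cases ?_ (fun j => ?_) i
      · simpa only [Fin.cons_zero] using DefFun.const _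
      · simpa only [Fin.cons_succ] using DefFun.coord _
    · have := hrat (Fin.cons q p) (Fin.cases (by simpa using hq) (by simpa using hp))
      have e : (Fin.cons (q : K) fun i => (p i : K) : Fin (n + 1) → K) =
          fun i => ((Fin.cons q p : Fin (n + 1) → ℚ) i : K) := by
        ext i
        refine Fin.cases ?_ (fun j => ?_) i <;> simp
      exact mem_ofPred_eq ▸ e ▸ this

end Interior

end TDeriv

namespace TDeriv

open FirstOrder FirstOrder.Language Set

/-! ### Nonvanishing of a Wronskian -/

section Wronskian

variable {K : Type w} [Field K] [CharZero K] (D : Derivation ℚ K K)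

theorem iterate_succ_mul (t : K) (j : ℕ) : ∃ c : ℕ → K, c j = (j + 1) * D t ∧
    ∀ x, D^[j + 1] (t * x) = t * D^[j + 1] x + ∑ k ∈ Finset.range (j + 1), c k * D^[k] x := by
  induction j with
  | zero => exact ⟨fun _ => D t, by simp, fun x => by simp [mul_comm]⟩
  | succ j ih =>
    obtain ⟨c, hcj, hc⟩ := ih
    -- Differentiating the coefficients gives `D (c k)`, differentiating the iterates shifts `c`,
    -- and the term `t * D^[j + 1] x` contributes `D t` at `k = j + 1`.
    refine ⟨fun k => (if k ≤ j then D (c k) else D t) + if k = 0 then 0 else c (k - 1), ?_, fun x => ?_⟩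
    · simp [hcj]
      ring
    · rw [Function.iterate_succ_apply', hc, Function.iterate_succ_apply' _ (j + 1) x]
      simp only [add_mul, Finset.sum_add_distrib]
      rw [Finset.sum_range_succ (fun k => (if k ≤ j then D (c k) else D t) * D^[k] x),
        Finset.sum_range_succ' (fun k => (if k = 0 then 0 else c (k - 1)) * D^[k] x)]
      have e : ∑ k ∈ Finset.range (j + 1), (if k ≤ j then D (c k) else D t) * D^[k] x =
          ∑ k ∈ Finset.range (j + 1), D (c k) * D^[k] x :=
        Finset.sum_congr rfl fun k hk => by
          rw [if_pos (Nat.lt_succ_iff.1 (Finset.mem_range.1 hk))]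
      rw [e]
      simp only [map_add, map_sum, Derivation.leibniz, smul_eq_mul, Finset.sum_add_distrib,
        Function.iterate_succ_apply', if_neg (Nat.not_succ_le_self j), Nat.succ_ne_zero, if_true,
        if_false, Nat.add_sub_cancel, zero_mul, add_zero]
      simp only [mul_comm (D^[_] x)]
      ring

/-- A nonzero linear differential operator of order at most `m` does not annihilate all of
`s, s * t, …, s * t ^ m` if `t` is not a constant and `s ≠ 0`. -/
theorem eq_zero_of_annihilates {s t : K} (hs : s ≠ 0) (ht : D t ≠ 0) (m : ℕ) (a : ℕ → K)
    (ha : ∀ i ≤ m, ∑ j ∈ Finset.range (m + 1), a j * D^[j] (s * t ^ i) = 0) :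
    ∀ j ≤ m, a j = 0 := by
  induction m generalizing a with
  | zero => simpa [hs] using ha 0 le_rfl
  | succ m ih =>
    choose c hcj hc using iterate_succ_mul D t
    -- These are the coefficients of the commutator of the operator with multiplication by `t`. It
    -- has order at most `m` and kills `s * t ^ i` for `i ≤ m`.
    have hb := ih (fun k => ∑ j ∈ Finset.Ico k (m + 1), a (j + 1) * c j k) (fun i hi => by
      have h0 := ha i (hi.trans (Nat.le_succ m))
      have h1 := ha (i + 1) (Nat.succ_le_succ hi)
      rw [show s * t ^ (i + 1) = t * (s * t ^ i) by ring] at h1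
      generalize s * t ^ i = x at h0 h1
      rw [Finset.sum_range_succ'] at h0 h1
      simp only [hc, mul_add, Finset.sum_add_distrib] at h1
      have h2 : ∑ j ∈ Finset.range (m + 1), a (j + 1) * ∑ k ∈ Finset.range (j + 1), c j k * D^[k] x
          = 0 := by
        have h3 : ∑ j ∈ Finset.range (m + 1), a (j + 1) * (t * D^[j + 1] x) =
            t * ∑ j ∈ Finset.range (m + 1), a (j + 1) * D^[j + 1] x := by
          rw [Finset.mul_sum]
          exact Finset.sum_congr rfl fun _ _ => by ring
        rw [h3] at h1
        simp only [Function.iterate_zero, id_eq] at h0 h1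
        linear_combination h1 - t * h0
      simp only [Finset.mul_sum, Finset.sum_mul] at h2 ⊢
      rw [← h2]
      refine (Finset.sum_comm' fun k j => ?_).trans
        (Finset.sum_congr rfl fun j _ => Finset.sum_congr rfl fun k _ => by ring)
      simp only [Finset.mem_range, Finset.mem_Ico]
      omega)
    -- The top coefficient of the commutator is `a (m + 1) * ((m + 1) * D t)`.
    have hm : a (m + 1) = 0 := by
      have := hb m le_rfl
      simp only [Nat.Ico_succ_singleton, Finset.sum_singleton, hcj] at this
      simpa [ht, Nat.cast_add_one_ne_zero] using this
    have hlt := ih a fun i hi => by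
      simpa [Finset.sum_range_succ _ (m + 1), hm] using ha i (hi.trans (Nat.le_succ m))
    intro j hj
    rcases Nat.le_succ_iff.1 hj with hj | rfl
    exacts [hlt j hj, hm]

/-- The Wronskian matrix of `s, s * t, …, s * t ^ r`. -/
def wronskianMatrix (s t : K) (r : ℕ) : Matrix (Fin (r + 1)) (Fin (r + 1)) K :=
  fun j i => D^[j] (s * t ^ (i : ℕ))

/-- A left kernel vector would be the coefficient sequence of a nonzero operator excluded by
`eq_zero_of_annihilates`. -/
theorem det_wronskianMatrix_ne_zero {s t : K} (hs : s ≠ 0) (ht : D t ≠ 0) (r : ℕ) :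
    (wronskianMatrix D s t r).det ≠ 0 := by
  intro h0
  obtain ⟨a, ha0, ha⟩ := Matrix.exists_vecMul_eq_zero_iff.2 h0
  refine ha0 (funext fun j => ?_)
  have := eq_zero_of_annihilates D hs ht r (fun j => if h : j < r + 1 then a ⟨j, h⟩ else 0)
    (fun i hi => by
      have := congrFun ha ⟨i, Nat.lt_succ_of_le hi⟩
      rw [Finset.sum_range]
      simpa [Matrix.vecMul, dotProduct, wronskianMatrix, Fin.is_le] using this) j (Nat.lt_succ_iff.1 j.2)
  simpa [Fin.is_le] using this

theorem jet_add_sum (s t a : K) (r : ℕ) (q : Fin (r + 1) → ℚ) :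
    jet D r (a + ∑ i, (q i : K) * (s * t ^ (i : ℕ))) =
      jet D r a + (wronskianMatrix D s t r).mulVec fun i => (q i : K) := by
  ext j
  have e : ∀ x, D^[j] x = ((D : K →ₗ[ℚ] K) ^ (j : ℕ)) x := fun x => by
    rw [Module.End.pow_apply]
    rfl
  simp only [jet, Pi.add_apply, Matrix.mulVec, dotProduct, wronskianMatrix, e, map_add, map_sum,
    ← Rat.smul_def, map_smul]
  simp only [Rat.smul_def, mul_comm]

end Wronskian

end TDeriv

namespace TDeriv

open FirstOrder FirstOrder.Language Set

/-! ### `T`-derivations, dimension and the conclusion -/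

section TDerivations

variable {L : FirstOrder.Language.{u, v}} {ι : orderedRing →ᴸ L}
  {K : Type w} [Field K] [LinearOrder K] [L.Structure K]

theorem IsCompatible.definableFun_add (hK : IsCompatible ι K) :
    (∅ : Set K).DefinableFun L (fun x : Fin 2 → K => x 0 + x 1) := by
  have := DefinableFun.fun_symbol (M := K) (ι.onFunction (n := 2) Ring.addFunc)
  convert this using 1
  ext x
  rw [← hK.add]
  congr 1
  ext i
  fin_cases i <;> rfl

theorem IsCompatible.definableFun_mul (hK : IsCompatible ι K) :
    (∅ : Set K).DefinableFun L (fun x : Fin 2 → K => x 0 * x 1) := by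
  have := DefinableFun.fun_symbol (M := K) (ι.onFunction (n := 2) Ring.mulFunc)
  convert this using 1
  ext x
  rw [← hK.mul]
  congr 1
  ext i
  fin_cases i <;> rfl

theorem IsCompatible.isOMinimalField (hK : IsCompatible ι K) (ho : IsOMinimalStructure ι K) :
    IsOMinimalField L K where
  lt := by
    refine Definable.mono (A := ∅) ?_ (empty_subset _)
    rw [empty_definable_iff]
    refine ⟨(ι.onRelation ltSymb).formula₂ (Term.var 0) (Term.var 1), ?_⟩
    ext x
    simpa [Formula.realize_rel₂] using! (hK.lt (x 0) (x 1)).symm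
  add := hK.definableFun_add.of_empty
  mul := hK.definableFun_mul.of_empty
  omin S hS := by
    have e : ltOf ι K = fun a b => a < b := by
      ext a b
      exact hK.lt a b
    simpa only [e] using ho S hS

omit [Field K] [LinearOrder K] in
theorem definable_graphOn_univ {n : ℕ} {F : (Fin n → K) → K}
    (hF : (∅ : Set K).DefinableFun L F) : (∅ : Set K).Definable L (graphOn F univ) := by
  have : (∅ : Set K).DefinableFun L (fun y : Fin (n + 1) → K => F (Fin.init y)) :=
    DefinableFun.comp (g := fun y => Fin.init y) (fun i => DefinableFun.proj L) hF
  simpa [graphOn] using (DefinableFun.proj L (i := Fin.last n)).ofPred_eq this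

variable [IsStrictOrderedRing K] [TopologicalSpace K] [OrderTopology K] {D : K → K}

omit [LinearOrder K] [L.Structure K] [IsStrictOrderedRing K] [OrderTopology K] in
theorem hasPartialDerivAt_of_forall {n : ℕ} {F : (Fin n → K) → K} {i : Fin n} {u : Fin n → K}
    {d : K} (h : ∀ x, F (Function.update u i (u i + x)) - F u = d * x) :
    HasPartialDerivAt F i u d := by
  refine tendsto_const_nhds.congr' ?_
  filter_upwards [self_mem_nhdsWithin] with x hx
  rw [h, mul_div_cancel_right₀ _ hx]

omit [IsStrictOrderedRing K] [OrderTopology K] in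
theorem IsTDerivation.map_add (hD : IsTDerivation L D) (hK : IsCompatible ι K) (x y : K) :
    D (x + y) = D x + D y := by
  have := hD 2 univ (fun u => u 0 + u 1) (fun _ _ => 1)
    (definable_graphOn_univ hK.definableFun_add)
    ⟨isOpen_univ, fun u _ i => hasPartialDerivAt_of_forall fun x => by
      fin_cases i <;> simp, fun i => continuousOn_const⟩ ![x, y] trivial
  simpa using this

omit [IsStrictOrderedRing K] [OrderTopology K] in
theorem IsTDerivation.map_mul (hD : IsTDerivation L D) (hK : IsCompatible ι K) (x y : K) :
    D (x * y) = x * D y + y * D x := by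
  have := hD 2 univ (fun u => u 0 * u 1) (fun u => ![u 1, u 0])
    (definable_graphOn_univ hK.definableFun_mul)
    ⟨isOpen_univ, fun u _ i => hasPartialDerivAt_of_forall fun x => by
      fin_cases i <;> simp <;> ring, fun i => by
      fin_cases i
      · exact (continuous_apply (A := fun _ : Fin 2 => K) 1).continuousOn
      · exact (continuous_apply (A := fun _ : Fin 2 => K) 0).continuousOn⟩ ![x, y] trivial
  simp at this
  rw [this, add_comm]

-- Addition and multiplication are `C¹` and definable without parameters; compatibility with these
-- two functions is all that the argument uses of a `T`-derivation.
omit [OrderTopology K] in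
theorem IsTDerivation.exists_derivation (hD : IsTDerivation L D) (hK : IsCompatible ι K) :
    ∃ D' : Derivation ℚ K K, ⇑D' = D :=
  ⟨Derivation.mk' (AddMonoidHom.toRatLinearMap (AddMonoidHom.mk' D (hD.map_add hK)))
    (hD.map_mul hK), rfl⟩

-- Projecting to all `r + 1` coordinates is the identity, so nonempty interior would force dimension
-- `r + 1`.
omit [Field K] [LinearOrder K] [L.Structure K] [IsStrictOrderedRing K] [OrderTopology K] in
theorem interior_eq_empty_of_odim_le {r : ℕ} {A : Set (Fin (r + 1) → K)}
    (hA : odim A ≤ ((r : ℕ∞) : WithBot ℕ∞)) : interior A = ∅ := by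
  by_contra hne
  have hne' : (interior
      ((fun x : Fin (r + 1) → K => x ∘ RelEmbedding.refl (· ≤ ·)) '' A)).Nonempty := by
    have : (fun x : Fin (r + 1) → K => x ∘ RelEmbedding.refl (· ≤ ·)) '' A = A := by
      convert image_id A
      rfl
    rw [this]
    exact nonempty_iff_ne_empty.2 hne
  have h1 : (((r + 1 : ℕ) : ℕ∞) : WithBot ℕ∞) ≤ odim A :=
    le_iSup_of_le (r + 1) (le_iSup_of_le (RelEmbedding.refl _) (le_iSup_of_le hne' le_rfl))
  have h2 := h1.trans hA
  rw [WithBot.coe_le_coe, Nat.cast_le] at h2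
  omega

/-- The preimage of a set with empty interior under an invertible affine map has empty interior. -/
theorem interior_preimage_affine_eq_empty {n : ℕ} {W : Matrix (Fin n) (Fin n) K} (hW : W.det ≠ 0)
    (b : Fin n → K) {A : Set (Fin n → K)} (hA : interior A = ∅) :
    interior {x | b + W.mulVec x ∈ A} = ∅ := by
  by_contra hne
  obtain ⟨x, hx⟩ := nonempty_iff_ne_empty.2 hne
  have hu : IsUnit W.det := isUnit_iff_ne_zero.2 hW
  have hcont : Continuous fun z : Fin n → K => W⁻¹.mulVec (z - b) :=
    continuous_const.matrix_mulVec (continuous_id.sub continuous_const)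
  have hsub : (fun z : Fin n → K => W⁻¹.mulVec (z - b)) ⁻¹' interior {x | b + W.mulVec x ∈ A} ⊆
      interior A := by
    refine interior_maximal (fun z hz => ?_) (isOpen_interior.preimage hcont)
    have := interior_subset hz
    simpa [Matrix.mul_nonsing_inv _ hu] using this
  rw [hA] at hsub
  refine hsub (a := b + W.mulVec x) ?_
  simpa [Matrix.nonsing_inv_mul _ hu] using hx

theorem IsOMinimalField.not_isThin (h : IsOMinimalField L K) (D : Derivation ℚ K K)
    {t : K} (ht : D t ≠ 0) {I : Set K} (hI : IsOpenInterval (fun a b : K => a < b) I) :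
    ¬ IsThin L D I := by
  rintro ⟨r, A, hA, hdim, hjet⟩
  obtain ⟨a, b, hab, hsub⟩ := hI.exists_Ioo
  have hM : 0 < 1 + |t| := by positivity
  have hM1 : 1 ≤ 1 + |t| := by simp
  -- The power of `1 + |t| ≥ 1` dominates every `|t| ^ i` with `i ≤ r`; `r + 2` rather than `r + 1`
  -- keeps the sum of the `r + 1` terms strictly below `(b - a) / 2`. Nothing makes `s` a constant
  -- of `D`, hence its place in the Wronskian.
  set s : K := (b - a) / 2 / ((r + 2) * (1 + |t|) ^ r) with hs
  have hba : 0 < (b - a) / 2 := half_pos (sub_pos.2 hab)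
  have hs0 : 0 < s := by positivity
  have hW := det_wronskianMatrix_ne_zero D hs0.ne' ht r
  set W := wronskianMatrix D s t r
  let c : K := (a + b) / 2
  have hBdef : DefPred L (fun x => x ∈ {x | jet D r c + W.mulVec x ∈ A}) := by
    refine DefPred.subst (q := fun x => x ∈ A) hA fun j => ?_
    change DefFun L (fun x => jet D r c j + ∑ i, W j i * x i)
    exact h.defFun_add (DefFun.const _) (h.defFun_sum _ fun i =>
      h.defFun_mul (DefFun.const _) (DefFun.coord _))
  refine (h.interior_nonempty_of_rat_mem hBdef fun q hq => ?_).ne_empty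
    (interior_preimage_affine_eq_empty hW _ (interior_eq_empty_of_odim_le hdim))
  have hterm : ∀ i : Fin (r + 1), |(q i : K) * (s * t ^ (i : ℕ))| ≤ (b - a) / 2 / (r + 2) := by
    intro i
    have hq0 : (0 : K) ≤ q i := by exact_mod_cast (hq i).1.le
    have hq1 : (q i : K) ≤ 1 := by exact_mod_cast (hq i).2.le
    have htp : |t| ^ (i : ℕ) ≤ (1 + |t|) ^ r :=
      (pow_le_pow_left₀ (abs_nonneg t) (by simp) _).trans
        (pow_le_pow_right₀ hM1 (Nat.lt_succ_iff.1 i.2))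
    rw [abs_mul, abs_mul, abs_pow, abs_of_nonneg hq0, abs_of_pos hs0]
    calc (q i : K) * (s * |t| ^ (i : ℕ)) ≤ 1 * (s * (1 + |t|) ^ r) := by gcongr
      _ = (b - a) / 2 / (r + 2) := by
        rw [hs]
        field_simp
  have hsum : |∑ i, (q i : K) * (s * t ^ (i : ℕ))| < (b - a) / 2 := by
    refine (Finset.abs_sum_le_sum_abs _ _).trans_lt
      ((Finset.sum_le_sum fun i _ => hterm i).trans_lt ?_)
    rw [Finset.sum_const, Finset.card_univ, Fintype.card_fin, nsmul_eq_mul, ← mul_div_assoc,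
      div_lt_iff₀ (by positivity), mul_comm]
    refine mul_lt_mul_of_pos_left ?_ hba
    push_cast
    linarith
  refine hjet ⟨_, hsub ?_, jet_add_sum D s t c r q⟩
  obtain ⟨h1, h2⟩ := abs_lt.1 hsum
  constructor <;> simp only [c] <;> linarith

end TDerivations

end TDeriv

theorem mainTheorem6 {L : FirstOrder.Language.{u, v}} (ι : TDeriv.orderedRing →ᴸ L)
    (T : L.Theory) (hcomplete : T.IsComplete)
    (hmodelComplete : TDeriv.IsModelComplete.{u, v, w} T)
    (homin : TDeriv.IsOMinimal.{u, v, w} ι T) (hRCF : TDeriv.ExtendsRCF ι T)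
    (K : Type w) [Field K] [LinearOrder K] [IsStrictOrderedRing K]
    [TopologicalSpace K] [OrderTopology K] [L.Structure K]
    (hK : TDeriv.IsCompatible ι K) (hKT : K ⊨ T)
    (D : K → K) (hD : TDeriv.IsTDerivation L D) (hnontrivial : ∃ x, D x ≠ 0)
    (I : Set K) (hI : TDeriv.IsOpenInterval (fun a b : K => a < b) I) :
    ¬ TDeriv.IsThin L D I := by
  obtain ⟨D, rfl⟩ := hD.exists_derivation hK
  obtain ⟨t, ht⟩ := hnontrivial
  exact (hK.isOMinimalField (homin (FirstOrder.Language.Theory.ModelType.of T K))).not_isThin D ht hI
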